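/- Let $p$ be a prime with $p\equiv 1\pmod 4$, let $m\ge 2$, $q=p^m$, $\zeta_p=e^{2\pi i/p}$, and let $\mathrm{Tr}$ be the trace from $\mathbb F_q$ to $\mathbb F_p$. For $f:\mathbb F_q\to\mathbb F_p$ put $\widehat\chi_f(\beta)=\sum_{x\in\mathbb F_q}\zeta_p^{f(x)-\mathrm{Tr}(\beta x)}$. For $0\le s\le m$, $f$ is $s$-plateaued if $|\widehat\chi_f(\beta)|^2\in\{0,p^{m+s}\}$ for all $\beta$; then $\mathcal S_f=\{\beta:|\widehat\chi_f(\beta)|^2=p^{m+s}\}$. It is weakly regular if there are a complex number $u$ with $|u|=1$ and a function $h_0:\mathbb F_q\to\mathbb F_p$, vanishing off $\mathcal S_f$, such that $\widehat\chi_f(\beta)\in\{0,\,u\,p^{(m+s)/2}\zeta_p^{h_0(\beta)}\}$ for all $\beta$. In that case there are a unique sign $\varepsilon_f\in\{\pm1\}$ and a unique function $f^\star:\mathbb F_q\to\mathbb F_p$, vanishing off $\mathcal S_f$, with $\widehat\chi_f(\beta)=\varepsilon_f\sqrt p^{\,m+s}\zeta_p^{f^\star(\beta)}$ for all $\beta\in\mathcal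 S_f$. Let WRP (respectively WRPB) be the class of weakly regular plateaued functions $f$ with $\widehat\chi_f(0)\ne0$ (respectively $\widehat\chi_f(0)=0$) such that $f(0)=0$ and, for some even integer $h>0$ with $\gcd(h-1,p-1)=1$, $f(zx)=z^hf(x)$ for all $z\in\mathbb F_p^*$, $x\in\mathbb F_q$. An index of such an $f$ is an even integer $l_f>0$ with $\gcd(l_f-1,p-1)=1$ and $f^\star(z\beta)=z^{l_f}f^\star(\beta)$ for all $z\in\mathbb F_p^*$, $\beta\in\mathcal S_f$. For $f,g:\mathbb F_q\to\mathbb F_p$ let $D_{f,g}=\{(x,y)\in\mathbb F_q^2\setminus\{(0,0)\}: f(x)+g(y)=0\}$ and $$C_{D_{f,g}}=\bigl\{(\mathrm{Tr}(ax+by))_{(x,y)\in D_{f,g}}: a,b\in\mathbb F_q\bigr\}.$$ A linear code over $\mathbb F_p$ is minimal if, whenever $\mathbf c,\mathbf c'$ are nonzero codewords with $\mathrm{supp}(\mathbf c')\subseteq\mathrm{supp}(\mathbf c)$, one has $\mathbf c'=z\mathbf c$ for some $z\in\mathbb F_p^*$. Let $w_{\min}$ and $w_{\max}$ be the least and greatest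 Hamming weights of nonzero codewords of $C_{D_{f,g}}$. **Theorem.** Let $f$ be $s$-plateaued with index $l_f$ and let $g$ be $t$-plateaued with index $l_g=\frac{p-1}2$. In each of the following cases $C_{D_{f,g}}$ satisfies $w_{\min}/w_{\max}>(p-1)/p$ and is minimal. 1. $f,g\in$ WRP or $f,g\in$ WRPB; $s+t$ is odd; $l_f=\frac{p-1}2$, or $l_f=p-1$, or $l_f=2$ and $p\equiv1\pmod 8$; and $2m-s-t\ge5$. 2. $f,g\in$ WRP; $s+t$ is even; $l_f\in\{2,\frac{p-1}2,p-1\}$; and either $\varepsilon_f\varepsilon_g=1$ and $2m-s-t\ge4$, or $\varepsilon_f\varepsilon_g=-1$ and $2m-s-t\ge6$. 3. $f,g\in$ WRPB; $s+t$ is even; $l_f\in\{2,\frac{p-1}2,p-1\}$; and $2m-s-t\ge4$. -/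

import Mathlib

namespace PlateauedCode

/-! ## Plateaued functions -/

section Plateaued

variable {p : ℕ} [Fact p.Prime] {F : Type*} [Field F] [Fintype F] [Algebra (ZMod p) F]

/-- The Walsh transform `β ↦ ∑ x, ζ_p ^ (f x - Tr (β x))`, where `Tr` is the absolute trace and
`ZMod.stdAddChar c = exp (2 π i c / p)`. -/
noncomputable def walsh (f : F → ZMod p) (β : F) : ℂ :=
  ∑ x : F, ZMod.stdAddChar (f x - Algebra.trace (ZMod p) F (β * x))

/-- `f` is `s`-plateaued on the field with `p ^ m` elements. -/
def IsPlateaued (m s : ℕ) (f : F → ZMod p) : Prop :=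
  s ≤ m ∧ ∀ β : F, ‖walsh f β‖ ^ 2 = 0 ∨ ‖walsh f β‖ ^ 2 = (p : ℝ) ^ (m + s)

/-- The Walsh support `S_f` of an `s`-plateaued function. -/
def walshSupport (m s : ℕ) (f : F → ZMod p) : Set F :=
  {β | ‖walsh f β‖ ^ 2 = (p : ℝ) ^ (m + s)}

/-- Weakly regular `s`-plateaued functions: the unit `u` does not depend on `β`. Here
`√p ^ (m + s)` is `p ^ ((m + s) / 2)`. -/
def IsWeaklyRegularPlateaued (m s : ℕ) (f : F → ZMod p) : Prop :=
  IsPlateaued m s f ∧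
    ∃ (u : ℂ) (g : F → ZMod p), ‖u‖ = 1 ∧ (∀ β ∉ walshSupport m s f, g β = 0) ∧
      ∀ β : F, walsh f β = 0 ∨
        walsh f β = u * (Real.sqrt p : ℂ) ^ (m + s) * ZMod.stdAddChar (g β)

/-- The homogeneity conditions: `f 0 = 0`, and `f (z x) = z ^ h f x` for all `z ∈ F_p^*`, for some
even positive `h` with `gcd (h - 1, p - 1) = 1`. -/
def IsHomogeneous (f : F → ZMod p) : Prop :=
  f 0 = 0 ∧ ∃ h : ℕ, 0 < h ∧ 2 ∣ h ∧ Nat.gcd (h - 1) (p - 1) = 1 ∧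
    ∀ z : ZMod p, z ≠ 0 → ∀ x : F, f (z • x) = z ^ h * f x

/-- The class WRP of unbalanced functions. -/
def WRP (m s : ℕ) (f : F → ZMod p) : Prop :=
  IsWeaklyRegularPlateaued m s f ∧ walsh f 0 ≠ 0 ∧ IsHomogeneous f

/-- The class WRPB of balanced functions. -/
def WRPB (m s : ℕ) (f : F → ZMod p) : Prop :=
  IsWeaklyRegularPlateaued m s f ∧ walsh f 0 = 0 ∧ IsHomogeneous f

/-- `ε` is the sign of the Walsh transform of `f` and `f'` is the dual function of `f`
(for `p ≡ 1 mod 4`, where `√(p^*) = √p`). -/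
def IsSignAndDual (m s : ℕ) (f : F → ZMod p) (ε : ℤ) (f' : F → ZMod p) : Prop :=
  (ε = 1 ∨ ε = -1) ∧
    (∀ β ∈ walshSupport m s f,
      walsh f β = (ε : ℂ) * (Real.sqrt p : ℂ) ^ (m + s) * ZMod.stdAddChar (f' β)) ∧
    ∀ β ∉ walshSupport m s f, f' β = 0

/-- The pair consisting of the sign and the dual function. For `p ≡ 1 mod 4` a weakly regular
plateaued function has exactly one such pair (it is a fact, not a hypothesis, that there is one). -/
noncomputable def signAndDual (m s : ℕ) (f : F → ZMod p) : ℤ × (F → ZMod p) :=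
  Classical.epsilon fun P => IsSignAndDual m s f P.1 P.2

/-- The sign `ε_f` of the Walsh transform of `f`. -/
noncomputable def walshSign (m s : ℕ) (f : F → ZMod p) : ℤ :=
  (signAndDual m s f).1

/-- The dual function `f^⋆` of `f`. -/
noncomputable def dual (m s : ℕ) (f : F → ZMod p) : F → ZMod p :=
  (signAndDual m s f).2

/-- `l` is an index of `f`: an even positive integer with `gcd (l - 1, p - 1) = 1` and
`f^⋆ (z β) = z ^ l f^⋆ β` for all `z ∈ F_p^*` and all `β` in the Walsh support. -/
def IsIndex (m s : ℕ) (f : F → ZMod p) (l : ℕ) : Prop :=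
  0 < l ∧ Even l ∧ Nat.gcd (l - 1) (p - 1) = 1 ∧
    ∀ z : ZMod p, z ≠ 0 → ∀ β ∈ walshSupport m s f, dual m s f (z • β) = z ^ l * dual m s f β

/-! ## The code -/

/-- The defining set `{(x, y) ≠ (0, 0) | f x + g y = 0}`. -/
def definingSet (f g : F → ZMod p) : Set (F × F) :=
  {d | d ≠ (0, 0) ∧ f d.1 + g d.2 = 0}

noncomputable instance (f g : F → ZMod p) : Fintype (definingSet f g) :=
  Fintype.ofFinite _

/-- The codeword map `(a, b) ↦ (Tr (a x + b y))_{(x, y) ∈ D}`. -/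
noncomputable def encode (f g : F → ZMod p) : F × F →ₗ[ZMod p] (definingSet f g → ZMod p) where
  toFun c d := Algebra.trace (ZMod p) F (c.1 * d.1.1 + c.2 * d.1.2)
  map_add' c c' := by
    funext d
    simp only [Prod.fst_add, Prod.snd_add, Pi.add_apply, ← map_add]
    congr 1
    ring
  map_smul' z c := by
    funext d
    simp only [Prod.smul_fst, Prod.smul_snd, Pi.smul_apply, RingHom.id_apply, ← map_smul,
      smul_add, smul_mul_assoc]

/-- The linear code `C_{D_{f,g}}`. -/
noncomputable def code (f g : F → ZMod p) : Submodule (ZMod p) (definingSet f g → ZMod p) :=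
  LinearMap.range (encode f g)

end Plateaued

/-! ## Minimal codes -/

section Minimal

variable {p : ℕ} {ι : Type*}

/-- `c` covers `c'` if the support of `c` contains the support of `c'`. -/
def Covers (c c' : ι → ZMod p) : Prop :=
  Function.support c' ⊆ Function.support c

/-- A code is minimal if each of its nonzero codewords covers no nonzero codewords other than its
own nonzero scalar multiples. -/
def IsMinimalCode (C : Submodule (ZMod p) (ι → ZMod p)) : Prop :=
  ∀ c ∈ C, c ≠ 0 → ∀ c' ∈ C, c' ≠ 0 → Covers c c' → ∃ z : ZMod p, z ≠ 0 ∧ c' = z • c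

/-- The set of nonzero Hamming weights of a code. -/
def nonzeroWeights [Fintype ι] (C : Submodule (ZMod p) (ι → ZMod p)) : Set ℕ :=
  {w | ∃ c ∈ C, c ≠ 0 ∧ hammingNorm c = w}

/-- `w_min / w_max > (p - 1) / p`, for the least and the greatest nonzero weight. -/
def WeightRatioBound [Fintype ι] (C : Submodule (ZMod p) (ι → ZMod p)) : Prop :=
  ∃ wmin wmax : ℕ, IsLeast (nonzeroWeights C) wmin ∧ IsGreatest (nonzeroWeights C) wmax ∧
    (wmin : ℝ) / wmax > ((p : ℝ) - 1) / p

end Minimal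

end PlateauedCode

/-! Let q = p^m and, for c = (a, b), let N_c(j) count the points where f(x) + g(y) - Tr(ax + by) =
j. The product of Walsh values at a and b is ∑ N_c(j) ζ^j, and the deviation Δ(c) = p N_c(0) - q² is
the trace of this number from ℚ(ζ) to ℚ. Counting zeros over all scalar multiples of c ≠ 0 gives p²
wt(c) = (p-1)q² + (p-1)Δ(0) - ∑_{z≠0} Δ(zc) (`sq_mul_hammingNorm_encode`). Bounds lo ≤ Δ ≤ hi
therefore control every weight, and both conclusions follow, through the Ashikhmin–Barg argument,
from q² + Δ(0) - p·hi + (p-1)·lo > 0 (`weightRatioBound_and_isMinimalCode_of_deviation`).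

The possible deviations come from arithmetic in ℤ[ζ]: a Walsh product is 0 or ε√p^(2m+s+t) ζ^k with
one sign ε for all c. Its trace is explicit for s+t even, and a Gauss sum bounds it for s+t odd. The
existence of sign and dual rests on total ramification of p and Kronecker's theorem on roots of
unity.

It remains to find Δ(0). It vanishes in the balanced case. In the unbalanced case k = 0 at the
origin: since f and g are even functions, d ↦ -d pairs off all points but the origin, so N_0(0) is
odd and every other N_0(j) is even, which k ≠ 0 would contradict. The size conditions on 2m-s-t then
give the inequality. -/

namespace PlateauedCode

/-! ### Cyclotomic integers of absolute square p^n -/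

section CyclotomicIntegers

open NumberField NumberField.IsCMField

/-- In a cyclotomic field of odd prime conductor `p`, an integer of absolute square `p ^ n` is, up
to a sign and a root of unity, the `n`-th power of a square root of `p`. -/
theorem exists_eq_pow_mul_of_mul_complexConj {p : ℕ} [hp : Fact p.Prime] (hp2 : 2 < p)
    {K : Type*} [Field K] [NumberField K] [IsCMField K] [IsCyclotomicExtension {p} ℚ K]
    {ζ : K} (hζ : IsPrimitiveRoot ζ p) {w τ : 𝓞 K} {n : ℕ} (hτ : τ ^ 2 = (p : 𝓞 K))
    (hw : w * ringOfIntegersComplexConj K w = (p : 𝓞 K) ^ n) :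
    ∃ r : ℕ, (w : K) = ζ ^ r * (τ : K) ^ n ∨ (w : K) = -ζ ^ r * (τ : K) ^ n := by
  have hπ : Prime (hζ.toInteger - 1) := hζ.zeta_sub_one_prime'
  have hpπ := IsCyclotomicExtension.Rat.associated_zeta_sub_one_pow_prime p hζ
  have hp0 : (p : 𝓞 K) ≠ 0 := by exact_mod_cast hp.out.ne_zero
  have hτ0 : τ ≠ 0 := by rintro rfl; simp at hτ; exact hp0 hτ.symm
  have hwdvd : w ∣ (hζ.toInteger - 1) ^ ((p - 1) * n) := by
    rw [pow_mul]
    exact (Dvd.intro _ hw).trans ((hpπ.pow_pow (n := n)).symm.dvd)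
  obtain ⟨j, -, hj⟩ := (dvd_prime_pow hπ _).1 hwdvd
  -- Conjugation sends ζ to another primitive root, so it fixes the prime ζ - 1 up to a unit.
  have hσ : Associated (ringOfIntegersComplexConj K w) ((hζ.toInteger - 1) ^ j) := by
    have h1 := hj.map (ringOfIntegersComplexConj K)
    rw [map_pow] at h1
    exact h1.trans ((hζ.toInteger_isPrimitiveRoot.associated_sub_one_map_sub_one
      (ringOfIntegersComplexConj K)).symm.pow_pow)
  have hsq : Associated (w ^ 2) ((τ ^ n) ^ 2) := by
    have h1 : Associated (w ^ 2) (w * ringOfIntegersComplexConj K w) := by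
      rw [pow_two]
      exact (Associated.refl w).mul_mul (hj.trans hσ.symm)
    rwa [hw, ← hτ, ← pow_mul, mul_comm, pow_mul] at h1
  have hassoc : τ ^ n ∣ w :=
    -- Divisibility of squares descends to the elements themselves because the ring is integrally
    -- closed.
    (IsIntegrallyClosed.pow_dvd_pow_iff two_ne_zero).1 hsq.symm.dvd
  obtain ⟨v, hv⟩ := hassoc
  -- In a CM field conjugation commutes with every embedding, so the absolute square p^n holds at
  -- all places and Kronecker's theorem applies to v.
  have hnorm : ∀ φ : K →+* ℂ, ‖φ (v : K)‖ = 1 := by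
    intro φ
    have h1 : φ (w : K) * (starRingEnd ℂ) (φ (w : K)) = (p : ℂ) ^ n := by
      rw [← complexEmbedding_complexConj, ← map_mul, ← coe_ringOfIntegersComplexConj]
      have := congrArg (fun x : 𝓞 K => φ (x : K)) hw
      simpa using this
    have h2 : ‖φ (w : K)‖ ^ 2 = (p : ℝ) ^ n := by
      have := congrArg norm h1
      rwa [norm_mul, Complex.norm_conj, ← pow_two, norm_pow, Complex.norm_natCast] at this
    have h3 : ‖φ (τ : K)‖ ^ 2 = p := by
      have := congrArg (fun x : 𝓞 K => ‖φ (x : K)‖) hτ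
      simpa using this
    have h4 : ‖φ (w : K)‖ ^ 2 = (p : ℝ) ^ n * ‖φ (v : K)‖ ^ 2 := by
      rw [hv]
      simp only [map_mul, map_pow, norm_mul, norm_pow]
      rw [mul_pow, ← pow_mul, mul_comm n, pow_mul, h3]
    rw [h2] at h4
    have h5 : (p : ℝ) ^ n ≠ 0 := pow_ne_zero _ (by exact_mod_cast hp.out.ne_zero)
    have h6 : ‖φ (v : K)‖ ^ 2 = 1 := mul_left_cancel₀ h5 (by rw [← h4, mul_one])
    exact (pow_eq_one_iff_of_nonneg (norm_nonneg _) two_ne_zero).1 h6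
  obtain ⟨N, hN, hvN⟩ := Embeddings.pow_eq_one_of_norm_eq_one K ℂ v.isIntegral_coe hnorm
  have hodd : Odd p := hp.out.odd_of_ne_two hp2.ne'
  obtain ⟨r, -, hr⟩ := hζ.exists_pow_or_neg_mul_pow_of_isOfFinOrder hodd
    (isOfFinOrder_iff_pow_eq_one.2 ⟨N, hN, hvN⟩)
  refine ⟨r, ?_⟩
  rw [hv]
  rcases hr with h | h
  · left; simp [h, mul_comm]
  · right; simp [h, mul_comm]

end CyclotomicIntegers

/-! ### Integral combinations of p-th roots of unity -/

section CharacterSums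

variable {p : ℕ} [hp : Fact p.Prime]

theorem stdAddChar_eq_pow_val (j : ZMod p) :
    ZMod.stdAddChar j = (ZMod.stdAddChar (1 : ZMod p) : ℂ) ^ j.val := by
  rw [← AddChar.map_nsmul_eq_pow]; simp

theorem isPrimitiveRoot_stdAddChar_one :
    IsPrimitiveRoot (ZMod.stdAddChar (1 : ZMod p) : ℂ) p := by
  have h := Complex.isPrimitiveRoot_exp p hp.out.ne_zero
  have h2 := ZMod.stdAddChar_coe (N := p) 1
  simp only [Int.cast_one, mul_one] at h2
  rwa [h2]

theorem norm_stdAddChar (j : ZMod p) : ‖(ZMod.stdAddChar j : ℂ)‖ = 1 := by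
  rw [ZMod.stdAddChar_apply, Circle.norm_coe]

open Polynomial in
/-- An integral linear relation among the `p`-th roots of unity has constant coefficients. -/
theorem eq_of_sum_mul_stdAddChar_eq_zero {a : ZMod p → ℤ}
    (h : ∑ j, (a j : ℂ) * ZMod.stdAddChar j = 0) (i j : ZMod p) : a i = a j := by
  have hζ := isPrimitiveRoot_stdAddChar_one (p := p)
  -- P has degree at most p - 1 and vanishes at ζ, so it is a constant multiple of Φ_p = 1 + X + ...
  -- + X^(p-1).
  set P : ℤ[X] := ∑ j : ZMod p, C (a j) * X ^ j.val with hP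
  have hcoeff : ∀ j : ZMod p, P.coeff j.val = a j := by
    intro j
    simp [hP, coeff_X_pow, (ZMod.val_injective p).eq_iff]
  have hroot : aeval (ZMod.stdAddChar (1 : ZMod p) : ℂ) P = 0 := by
    rw [← h, hP, map_sum]
    exact Finset.sum_congr rfl fun j _ => by rw [stdAddChar_eq_pow_val j]; simp
  have hdvd : cyclotomic p ℤ ∣ P := by
    rw [cyclotomic_eq_minpoly hζ hp.out.pos]
    exact minpoly.isIntegrallyClosed_dvd (hζ.isIntegral hp.out.pos) hroot
  obtain ⟨Q, hQ⟩ := hdvd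
  have hdeg : P.natDegree ≤ p - 1 := by
    refine natDegree_sum_le_of_forall_le _ _ fun j _ => ?_
    refine (natDegree_C_mul_X_pow_le _ _).trans ?_
    have := ZMod.val_lt j
    omega
  obtain ⟨c, rfl⟩ : ∃ c, Q = C c := by
    by_cases hQ0 : Q = 0
    · exact ⟨0, by simp [hQ0]⟩
    · refine ⟨_, eq_C_of_natDegree_eq_zero ?_⟩
      rw [hQ, natDegree_mul (cyclotomic_ne_zero p ℤ) hQ0, natDegree_cyclotomic,
        Nat.totient_prime hp.out] at hdeg
      omega
  have hconst : ∀ j : ZMod p, a j = c := by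
    intro j
    rw [← hcoeff j, hQ, coeff_mul_C, cyclotomic_prime, finsetSum_coeff]
    simp [coeff_X_pow, ZMod.val_lt j]
  rw [hconst i, hconst j]

/-- Both sides are the trace to ℚ of the same cyclotomic integer; concretely, p a(0) - ∑ a(j) kills
constant coefficient vectors. -/
theorem card_mul_sub_sum_eq {a b : ZMod p → ℤ}
    (h : ∑ j, (a j : ℂ) * ZMod.stdAddChar j = ∑ j, (b j : ℂ) * ZMod.stdAddChar j) :
    (p : ℤ) * a 0 - ∑ j, a j = p * b 0 - ∑ j, b j := by
  have h1 : ∑ j, ((a - b) j : ℂ) * ZMod.stdAddChar j = 0 := by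
    simp [sub_mul, h]
  have h2 : ∑ j, (a j - b j) = ∑ j : ZMod p, (a 0 - b 0) :=
    Finset.sum_congr rfl fun j _ => eq_of_sum_mul_stdAddChar_eq_zero h1 j 0
  rw [Finset.sum_sub_distrib, Finset.sum_const, Finset.card_univ, ZMod.card, nsmul_eq_mul] at h2
  linarith

theorem gaussSum_quadraticChar_sq (hp4 : p % 4 = 1) {R : Type*} [CommRing R] [IsDomain R]
    [CharZero R] {ψ : AddChar (ZMod p) R} (hψ : ψ.IsPrimitive) :
    gaussSum ((quadraticChar (ZMod p)).ringHomComp (Int.castRingHom R)) ψ ^ 2 = (p : R) := by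
  have hp2 : ringChar (ZMod p) ≠ 2 := by
    rw [ZMod.ringChar_zmod_n]; rintro rfl; simp at hp4
  rw [gaussSum_sq _ _ hψ]
  · rw [ZMod.card, MulChar.ringHomComp_apply, quadraticChar_neg_one hp2, ZMod.card,
      ZMod.χ₄_nat_one_mod_four hp4]
    simp
  · exact (MulChar.ringHomComp_ne_one_iff (RingHom.injective_int _)).2 (quadraticChar_ne_one hp2)
  · exact (quadraticChar_isQuadratic _).comp _

/-- The quadratic Gauss sum squares to p. Its sign δ can stay undetermined, since it only enters
symmetric bounds and parity arguments. -/
theorem exists_sqrt_eq_sum (hp4 : p % 4 = 1) : ∃ δ : ℤ, (δ = 1 ∨ δ = -1) ∧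
    (Real.sqrt p : ℂ) = ∑ j : ZMod p, ((δ * quadraticChar (ZMod p) j : ℤ) : ℂ) *
      ZMod.stdAddChar j := by
  have h := gaussSum_quadraticChar_sq hp4 (ZMod.isPrimitive_stdAddChar p)
  have h2 : (Real.sqrt p : ℂ) ^ 2 = (p : ℂ) := by
    rw [← Complex.ofReal_pow, Real.sq_sqrt (Nat.cast_nonneg p), Complex.ofReal_natCast]
  rw [← h, sq_eq_sq_iff_eq_or_eq_neg] at h2
  rcases h2 with h2 | h2
  · exact ⟨1, Or.inl rfl, by rw [h2]; simp [gaussSum, MulChar.ringHomComp_apply]⟩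
  · exact ⟨-1, Or.inr rfl, by rw [h2]; simp [gaussSum, MulChar.ringHomComp_apply]⟩

/-- An integral combination of `p`-th roots of unity whose absolute square is `p ^ n` is
`± √p ^ n ζ ^ k`. -/
theorem exists_eq_sqrt_pow_mul_stdAddChar (hp4 : p % 4 = 1) (a : ZMod p → ℤ) (n : ℕ)
    (h : ‖∑ j, (a j : ℂ) * ZMod.stdAddChar j‖ ^ 2 = (p : ℝ) ^ n) :
    ∃ (ε : ℤ) (k : ZMod p), (ε = 1 ∨ ε = -1) ∧
      ∑ j, (a j : ℂ) * ZMod.stdAddChar j = ε * (Real.sqrt p : ℂ) ^ n * ZMod.stdAddChar k := by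
  have hp2 : 2 < p := by
    have := hp.out.two_le
    omega
  let K := CyclotomicField p ℚ
  have : IsCyclotomicExtension {p} ℚ K := CyclotomicField.isCyclotomicExtension p ℚ
  have : NumberField.IsCMField K :=
    IsCyclotomicExtension.Rat.isCMField K (S := {p}) ⟨p, rfl, hp2⟩
  obtain ⟨φ⟩ : Nonempty (K →+* ℂ) := inferInstance
  have hζ₀ : IsPrimitiveRoot (IsCyclotomicExtension.zeta p ℚ K) p :=
    IsCyclotomicExtension.zeta_spec p ℚ K
  obtain ⟨i, -, hi, hφi⟩ := (hζ₀.map_of_injective φ.injective).isPrimitiveRoot_iff.1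
    (isPrimitiveRoot_stdAddChar_one (p := p))
  -- The embedding φ is arbitrary, so the primitive root is adjusted to lie over exp(2πi/p).
  obtain ⟨ζ, hζ, hφ⟩ : ∃ ζ : K, IsPrimitiveRoot ζ p ∧ φ ζ = ZMod.stdAddChar (1 : ZMod p) :=
    ⟨_, hζ₀.pow_of_coprime i hi, by rw [map_pow, hφi]⟩
  have hζO := hζ.toInteger_isPrimitiveRoot
  set ψ := AddChar.zmodChar p ((IsPrimitiveRoot.iff_def _ p).1 hζO).left with hψdef
  have hψ : ∀ j, φ (ψ j : NumberField.RingOfIntegers K) = ZMod.stdAddChar j := by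
    intro j
    rw [stdAddChar_eq_pow_val, ← hφ, hψdef, AddChar.zmodChar_apply]
    simp only [map_pow]
    rfl
  set w : NumberField.RingOfIntegers K := ∑ j, (a j : NumberField.RingOfIntegers K) * ψ j with hw
  have hφw : φ w = ∑ j, (a j : ℂ) * ZMod.stdAddChar j := by
    rw [hw]; simp [hψ]
  have hww : w * NumberField.IsCMField.ringOfIntegersComplexConj K w =
      (p : NumberField.RingOfIntegers K) ^ n := by
    apply NumberField.RingOfIntegers.coe_injective
    apply φ.injective
    rw [map_mul, map_mul]
    change φ w * φ (NumberField.IsCMField.complexConj K w) = _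
    rw [NumberField.IsCMField.complexEmbedding_complexConj, Complex.mul_conj, hφw,
      Complex.normSq_eq_norm_sq, h]
    simp
  obtain ⟨τ, hτ⟩ : ∃ τ : NumberField.RingOfIntegers K, τ ^ 2 = p :=
    ⟨_, gaussSum_quadraticChar_sq hp4 (AddChar.zmodChar_primitive_of_primitive_root p hζO)⟩
  obtain ⟨r, hr⟩ := exists_eq_pow_mul_of_mul_complexConj hp2 hζ hτ hww
  have hτφ : φ τ = Real.sqrt p ∨ φ τ = -Real.sqrt p := by
    rw [← sq_eq_sq_iff_eq_or_eq_neg, ← Complex.ofReal_pow, Real.sq_sqrt (Nat.cast_nonneg p)]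
    have := congrArg (fun x : NumberField.RingOfIntegers K => φ x) hτ
    simpa using this
  have hτn : ∃ δ : ℤ, (δ = 1 ∨ δ = -1) ∧ φ τ ^ n = δ * (Real.sqrt p : ℂ) ^ n := by
    rcases hτφ with h1 | h1
    · exact ⟨1, Or.inl rfl, by simp [h1]⟩
    · exact ⟨(-1) ^ n, neg_one_pow_eq_or ℤ n, by rw [h1, neg_pow]; simp⟩
  obtain ⟨δ, hδ, hτn⟩ := hτn
  have hrj : φ ζ ^ r = ZMod.stdAddChar (r : ZMod p) := by
    rw [hφ, ← AddChar.map_nsmul_eq_pow]; simp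
  rw [← hφw]
  rcases hr with hr | hr
  · refine ⟨δ, r, hδ, ?_⟩
    rw [hr, map_mul, map_pow, map_pow, hrj, hτn]; ring
  · refine ⟨-δ, r, by omega, ?_⟩
    rw [hr, map_mul, map_neg, map_pow, map_pow, hrj, hτn]; push_cast; ring

end CharacterSums

/-! ### Sign and dual; Walsh products as counting sums -/

section SignAndDual

variable {p : ℕ} [hp : Fact p.Prime] {F : Type*} [Field F] [Fintype F] [Algebra (ZMod p) F]

theorem sum_stdAddChar_eq_sum_card {ι : Type*} [Fintype ι] (u : ι → ZMod p) :
    ∑ x, (ZMod.stdAddChar (u x) : ℂ) =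
      ∑ j, (((Finset.univ.filter fun x => u x = j).card : ℤ) : ℂ) * ZMod.stdAddChar j := by
  rw [← Finset.sum_fiberwise Finset.univ u]
  refine Finset.sum_congr rfl fun j _ => ?_
  rw [Finset.sum_congr rfl (g := fun _ => (ZMod.stdAddChar j : ℂ))
    fun x hx => by rw [(Finset.mem_filter.1 hx).2]]
  simp

theorem sum_card_filter_eq {ι : Type*} [Fintype ι] (u : ι → ZMod p) :
    ∑ j, ((Finset.univ.filter fun x => u x = j).card : ℤ) = Fintype.card ι := by
  rw [← Nat.cast_sum, ← Finset.card_univ, Finset.card_eq_sum_card_fiberwise (f := u)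
    (t := Finset.univ) (s := (Finset.univ : Finset ι)) (by simp)]

theorem exists_walsh_eq (hp4 : p % 4 = 1) {m s : ℕ} {f : F → ZMod p} {β : F}
    (hβ : β ∈ walshSupport m s f) :
    ∃ (ε : ℤ) (k : ZMod p), (ε = 1 ∨ ε = -1) ∧
      walsh f β = ε * (Real.sqrt p : ℂ) ^ (m + s) * ZMod.stdAddChar k := by
  have h : ‖walsh f β‖ ^ 2 = (p : ℝ) ^ (m + s) := hβ
  rw [walsh, sum_stdAddChar_eq_sum_card] at h ⊢
  exact exists_eq_sqrt_pow_mul_stdAddChar hp4 _ _ h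

theorem walsh_ne_zero_of_mem {m s : ℕ} {f : F → ZMod p} {β : F} (hβ : β ∈ walshSupport m s f) :
    walsh f β ≠ 0 := by
  intro h
  have h1 : ‖walsh f β‖ ^ 2 = (p : ℝ) ^ (m + s) := hβ
  rw [h] at h1
  have h2 : (p : ℝ) ^ (m + s) ≠ 0 := pow_ne_zero _ (by exact_mod_cast hp.out.ne_zero)
  exact h2 (by rw [← h1]; simp)

theorem IsPlateaued.mem_walshSupport {m s : ℕ} {f : F → ZMod p} (hf : IsPlateaued m s f) {β : F}
    (hβ : walsh f β ≠ 0) : β ∈ walshSupport m s f :=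
  (hf.2 β).resolve_left (by simpa using hβ)

/-- A weakly regular plateaued function has a sign and a dual function. -/
theorem IsWeaklyRegularPlateaued.exists_isSignAndDual (hp4 : p % 4 = 1) {m s : ℕ}
    {f : F → ZMod p} (hf : IsWeaklyRegularPlateaued m s f) :
    ∃ (ε : ℤ) (f' : F → ZMod p), IsSignAndDual m s f ε f' := by
  classical
  obtain ⟨hpl, u, g, -, -, hu⟩ := hf
  by_cases hS : ∃ β₀, β₀ ∈ walshSupport m s f
  · obtain ⟨β₀, hβ₀⟩ := hS
    obtain ⟨ε, k, hε, hk⟩ := exists_walsh_eq hp4 hβ₀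
    have h1 := (hu β₀).resolve_left (walsh_ne_zero_of_mem hβ₀)
    have hsq : (Real.sqrt p : ℂ) ^ (m + s) ≠ 0 := by
      refine pow_ne_zero _ ?_
      rw [Complex.ofReal_ne_zero]
      exact (Real.sqrt_pos.2 (by exact_mod_cast hp.out.pos)).ne'
    -- One point of the support determines the unit u; elsewhere the dual is g shifted by the
    -- constant k - g β₀.
    have hu' : u = ε * ZMod.stdAddChar (k - g β₀) := by
      have hne : (ZMod.stdAddChar (g β₀) : ℂ) ≠ 0 := by
        rw [← norm_ne_zero_iff, norm_stdAddChar]; exact one_ne_zero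
      rw [AddChar.map_sub_eq_div, mul_div_assoc', eq_div_iff hne]
      apply mul_right_cancel₀ hsq
      calc u * ZMod.stdAddChar (g β₀) * (Real.sqrt p : ℂ) ^ (m + s)
          = u * (Real.sqrt p : ℂ) ^ (m + s) * ZMod.stdAddChar (g β₀) := by ring
        _ = ε * (Real.sqrt p : ℂ) ^ (m + s) * ZMod.stdAddChar k := by rw [← h1, hk]
        _ = _ := by ring
    refine ⟨ε, fun β => if β ∈ walshSupport m s f then k - g β₀ + g β else 0, hε, ?_, ?_⟩
    · intro β hβ
      simp only [hβ, if_true]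
      rw [(hu β).resolve_left (walsh_ne_zero_of_mem hβ), hu', AddChar.map_add_eq_mul]
      ring
    · intro β hβ
      simp [hβ]
  · push Not at hS
    -- With empty support the sign condition is vacuous, so an arbitrary sign serves.
    exact ⟨1, 0, Or.inl rfl, fun β hβ => (hS β hβ).elim, fun _ _ => rfl⟩

theorem IsWeaklyRegularPlateaued.isSignAndDual (hp4 : p % 4 = 1) {m s : ℕ}
    {f : F → ZMod p} (hf : IsWeaklyRegularPlateaued m s f) :
    IsSignAndDual m s f (walshSign m s f) (dual m s f) := by
  obtain ⟨ε, f', h⟩ := hf.exists_isSignAndDual hp4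
  exact Classical.epsilon_spec (p := fun P : ℤ × (F → ZMod p) => IsSignAndDual m s f P.1 P.2)
    ⟨(ε, f'), h⟩

theorem IsWeaklyRegularPlateaued.walsh_eq_zero_or (hp4 : p % 4 = 1) {m s : ℕ}
    {f : F → ZMod p} (hf : IsWeaklyRegularPlateaued m s f) (β : F) :
    walsh f β = 0 ∨ ∃ k : ZMod p,
      walsh f β = walshSign m s f * (Real.sqrt p : ℂ) ^ (m + s) * ZMod.stdAddChar k := by
  by_cases h : walsh f β = 0
  · exact Or.inl h
  · exact Or.inr ⟨_, (hf.isSignAndDual hp4).2.1 β (hf.1.mem_walshSupport h)⟩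

/-- The two-variable exponent whose values are counted by a product of Walsh transforms. -/
noncomputable def phase (f g : F → ZMod p) (c d : F × F) : ZMod p :=
  f d.1 + g d.2 - Algebra.trace (ZMod p) F (c.1 * d.1 + c.2 * d.2)

/-- The number of points at which the phase takes the value `j`. -/
noncomputable def phaseCount (f g : F → ZMod p) (c : F × F) (j : ZMod p) : ℤ :=
  ((Finset.univ.filter fun d : F × F => phase f g c d = j).card : ℤ)

/-- The deviation of `phaseCount f g c 0` from its average value, multiplied by `p`. -/
noncomputable def deviation (f g : F → ZMod p) (c : F × F) : ℤ :=
  p * phaseCount f g c 0 - (Fintype.card F : ℤ) ^ 2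

theorem sum_phaseCount (f g : F → ZMod p) (c : F × F) :
    ∑ j, phaseCount f g c j = (Fintype.card F : ℤ) ^ 2 := by
  unfold phaseCount
  rw [sum_card_filter_eq, Fintype.card_prod, Nat.cast_mul, pow_two]

theorem walsh_mul_walsh (f g : F → ZMod p) (c : F × F) :
    walsh f c.1 * walsh g c.2 = ∑ j, (phaseCount f g c j : ℂ) * ZMod.stdAddChar j := by
  unfold phaseCount
  rw [← sum_stdAddChar_eq_sum_card, walsh, walsh, Finset.sum_mul_sum, Fintype.sum_prod_type]
  refine Finset.sum_congr rfl fun x _ => Finset.sum_congr rfl fun y _ => ?_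
  rw [← AddChar.map_add_eq_mul, phase, map_add (Algebra.trace (ZMod p) F)]
  congr 1
  ring

theorem deviation_eq {f g : F → ZMod p} {c : F × F} {b : ZMod p → ℤ}
    (h : walsh f c.1 * walsh g c.2 = ∑ j, (b j : ℂ) * ZMod.stdAddChar j) :
    deviation f g c = p * b 0 - ∑ j, b j := by
  rw [deviation, ← sum_phaseCount f g c]
  exact card_mul_sub_sum_eq ((walsh_mul_walsh f g c).symm.trans h)

theorem phaseCount_sub_eq {f g : F → ZMod p} {c : F × F} {b : ZMod p → ℤ}
    (h : walsh f c.1 * walsh g c.2 = ∑ j, (b j : ℂ) * ZMod.stdAddChar j) (i j : ZMod p) :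
    phaseCount f g c i - b i = phaseCount f g c j - b j := by
  refine eq_of_sum_mul_stdAddChar_eq_zero (a := fun j => phaseCount f g c j - b j) ?_ i j
  simp [sub_mul, ← walsh_mul_walsh, h]

end SignAndDual

/-! ### Weights in terms of deviations -/

section Weights

variable {p : ℕ} [hp : Fact p.Prime] {F : Type*} [Field F] [Fintype F] [Algebra (ZMod p) F]

/-- The functional `(x, y) ↦ Tr (a x + b y)`. -/
noncomputable def traceFunctional (c : F × F) : F × F →+ ZMod p where
  toFun d := Algebra.trace (ZMod p) F (c.1 * d.1 + c.2 * d.2)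
  map_zero' := by simp
  map_add' d d' := by
    rw [← map_add]
    congr 1
    simp only [Prod.fst_add, Prod.snd_add]
    ring

theorem traceFunctional_surjective {c : F × F} (hc : c ≠ 0) :
    Function.Surjective (traceFunctional (p := p) c) := by
  intro j
  have : Finite F := inferInstance
  obtain ⟨x, hx⟩ := Algebra.trace_surjective (ZMod p) F j
  by_cases h1 : c.1 = 0
  · have h2 : c.2 ≠ 0 := fun h2 => hc (Prod.ext h1 h2)
    refine ⟨(0, c.2⁻¹ * x), ?_⟩
    change Algebra.trace (ZMod p) F (c.1 * 0 + c.2 * (c.2⁻¹ * x)) = j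
    rw [mul_zero, zero_add, mul_inv_cancel_left₀ h2, hx]
  · refine ⟨(c.1⁻¹ * x, 0), ?_⟩
    change Algebra.trace (ZMod p) F (c.1 * (c.1⁻¹ * x) + c.2 * 0) = j
    rw [mul_zero, add_zero, mul_inv_cancel_left₀ h1, hx]

theorem card_mul_card_traceFunctional_eq_zero {c : F × F} (hc : c ≠ 0) :
    (p : ℤ) * (Finset.univ.filter fun d => traceFunctional (p := p) c d = 0).card =
      (Fintype.card F : ℤ) ^ 2 := by
  have h := sum_card_filter_eq (traceFunctional (p := p) c)
  rw [Fintype.card_prod, Nat.cast_mul, ← pow_two] at h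
  rw [← h, Finset.sum_congr rfl (g := fun _ =>
    ((Finset.univ.filter fun d => traceFunctional (p := p) c d = 0).card : ℤ))]
  · simp [ZMod.card]
  · intro j _
    rw [AddMonoidHom.card_fiber_eq_of_mem_range (traceFunctional (p := p) c)
      (traceFunctional_surjective hc j) (traceFunctional_surjective hc 0)]

/-- The origin, excluded from the defining set, may be readmitted because the functional vanishes
there. -/
theorem hammingNorm_encode (f g : F → ZMod p) (c : F × F) :
    hammingNorm (encode f g c) = (Finset.univ.filter fun d : F × F =>
      f d.1 + g d.2 = 0 ∧ traceFunctional (p := p) c d ≠ 0).card := by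
  rw [hammingNorm]
  refine Finset.card_bij (fun d _ => d.1) ?_ ?_ ?_
  · intro d hd
    exact Finset.mem_filter.2 ⟨Finset.mem_univ _, d.2.2, (Finset.mem_filter.1 hd).2⟩
  · intro d _ d' _ h
    exact Subtype.ext h
  · intro d hd
    obtain ⟨-, h1, h2⟩ := Finset.mem_filter.1 hd
    refine ⟨⟨d, ?_, h1⟩, Finset.mem_filter.2 ⟨Finset.mem_univ _, h2⟩, rfl⟩
    rintro rfl
    exact h2 (map_zero (traceFunctional (p := p) c))

omit [Fintype F] in
theorem phase_smul (f g : F → ZMod p) (c d : F × F) (z : ZMod p) :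
    phase f g (z • c) d = f d.1 + g d.2 - z * traceFunctional (p := p) c d := by
  rw [phase]
  congr 1
  change _ = z • Algebra.trace (ZMod p) F (c.1 * d.1 + c.2 * d.2)
  rw [← map_smul]
  simp

/-- Double count of pairs (z, d) with f + g = z·T(d), T being the trace functional of c: if T(d) ≠ 0
exactly one z works; if T(d) = 0, all p or none do, according to whether f + g vanishes at d. -/
theorem sum_phaseCount_smul (f g : F → ZMod p) (c : F × F) :
    ∑ z : ZMod p, phaseCount f g (z • c) 0 =
      (Fintype.card F : ℤ) ^ 2
        - (Finset.univ.filter fun d => traceFunctional (p := p) c d = 0).card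
        + p * (phaseCount f g 0 0 - hammingNorm (encode f g c)) := by
  have hpt : ∀ d : F × F, (∑ z : ZMod p, if phase f g (z • c) d = 0 then (1 : ℤ) else 0) =
      1 - (if traceFunctional (p := p) c d = 0 then 1 else 0) +
        p * ((if phase f g 0 d = 0 then 1 else 0) -
          (if f d.1 + g d.2 = 0 ∧ traceFunctional (p := p) c d ≠ 0 then 1 else 0)) := by
    intro d
    have h0 : phase f g 0 d = f d.1 + g d.2 := by simp [phase]
    simp only [phase_smul, h0]
    by_cases hT : traceFunctional (p := p) c d = 0
    · by_cases hfg : f d.1 + g d.2 = 0 <;> simp [hT, hfg, ZMod.card]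
    · have : ∀ z : ZMod p, f d.1 + g d.2 - z * traceFunctional (p := p) c d = 0 ↔
          z = (f d.1 + g d.2) / traceFunctional (p := p) c d := by
        intro z
        rw [sub_eq_zero, eq_div_iff hT, eq_comm]
      by_cases hfg : f d.1 + g d.2 = 0 <;> simp [this, hT, hfg]
  have h1 : ∑ z : ZMod p, phaseCount f g (z • c) 0 =
      ∑ d : F × F, ∑ z : ZMod p, if phase f g (z • c) d = 0 then (1 : ℤ) else 0 := by
    rw [Finset.sum_comm]
    exact Finset.sum_congr rfl fun z _ => by simp [phaseCount]
  rw [h1, Finset.sum_congr rfl fun d _ => hpt d, Finset.sum_add_distrib, Finset.sum_sub_distrib,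
    ← Finset.mul_sum, Finset.sum_sub_distrib, hammingNorm_encode, phaseCount]
  simp [pow_two]

theorem sq_mul_hammingNorm_encode (f g : F → ZMod p) {c : F × F} (hc : c ≠ 0) :
    (p : ℤ) ^ 2 * hammingNorm (encode f g c) =
      (p - 1) * (Fintype.card F : ℤ) ^ 2 + (p - 1) * deviation f g 0
        - ∑ z ∈ Finset.univ.erase (0 : ZMod p), deviation f g (z • c) := by
  have h1 := sum_phaseCount_smul f g c
  have h2 := card_mul_card_traceFunctional_eq_zero (p := p) hc
  have h3 : ∑ z ∈ Finset.univ.erase (0 : ZMod p), deviation f g (z • c) =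
      p * ∑ z : ZMod p, phaseCount f g (z • c) 0 - p * (Fintype.card F : ℤ) ^ 2 -
        deviation f g 0 := by
    rw [eq_sub_iff_add_eq]
    have := Finset.sum_erase_add Finset.univ (fun z : ZMod p => deviation f g (z • c))
      (Finset.mem_univ 0)
    rw [zero_smul] at this
    rw [this]
    simp only [deviation, Finset.sum_sub_distrib, ← Finset.mul_sum, Finset.sum_const,
      Finset.card_univ, ZMod.card, nsmul_eq_mul]
  have h4 : deviation f g 0 = p * phaseCount f g 0 0 - (Fintype.card F : ℤ) ^ 2 := rfl
  rw [h3, h1, h4]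
  linear_combination (-1 : ℤ) * h2

end Weights

/-! ### From weight inequalities to minimality -/

section CodeCriterion

variable {p : ℕ} [hp : Fact p.Prime] {ι : Type*} [Fintype ι]

/-- The Ashikhmin–Barg criterion. -/
theorem isMinimalCode_of_weights {C : Submodule (ZMod p) (ι → ZMod p)}
    (h : ∀ c ∈ C, c ≠ 0 → ∀ c' ∈ C, c' ≠ 0 →
      (p - 1) * (hammingNorm c' : ℤ) < p * hammingNorm c) : IsMinimalCode C := by
  intro c hc hc0 c' hc' hc0' hcov
  by_contra! hne
  -- On the support of c' exactly one nonzero z cancels the coordinate of c; off it none changes the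
  -- coordinate.
  have hsum : ∑ z ∈ Finset.univ.erase (0 : ZMod p), (hammingNorm (c - z • c') : ℤ) =
      (p - 1) * hammingNorm c - hammingNorm c' := by
    have hpt : ∀ i, (∑ z ∈ Finset.univ.erase (0 : ZMod p),
        if (c - z • c') i ≠ 0 then (1 : ℤ) else 0) =
        (p - 1) * (if c i ≠ 0 then 1 else 0) - (if c' i ≠ 0 then 1 else 0) := by
      intro i
      have hcard : ((Finset.univ.erase (0 : ZMod p)).card : ℤ) = p - 1 := by
        rw [Finset.card_erase_of_mem (Finset.mem_univ _), Finset.card_univ, ZMod.card,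
          Nat.cast_sub hp.out.one_le, Nat.cast_one]
      by_cases h' : c' i = 0
      · simp only [Pi.sub_apply, Pi.smul_apply, h', smul_zero, sub_zero, Finset.sum_const,
          nsmul_eq_mul, hcard, ne_eq, not_true_eq_false, if_false]
      · have hci : c i ≠ 0 := hcov h'
        have hz : ∀ z : ZMod p, (c - z • c') i ≠ 0 ↔ ¬ z = c i / c' i := by
          intro z
          rw [Pi.sub_apply, Pi.smul_apply, smul_eq_mul, ne_eq, sub_eq_zero, eq_div_iff h',
            eq_comm]
        have hmem : c i / c' i ∈ Finset.univ.erase (0 : ZMod p) :=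
          Finset.mem_erase.2 ⟨div_ne_zero hci h', Finset.mem_univ _⟩
        simp only [hz]
        rw [Finset.sum_congr rfl (g := fun z => 1 - (if z = c i / c' i then (1 : ℤ) else 0))
          (fun z _ => by split_ifs <;> simp), Finset.sum_sub_distrib, Finset.sum_const,
          nsmul_eq_mul, hcard, Finset.sum_ite_eq' , if_pos hmem]
        simp [hci, h']
    have hnorm : ∀ v : ι → ZMod p, (hammingNorm v : ℤ) = ∑ i, if v i ≠ 0 then (1 : ℤ) else 0 := by
      intro v
      rw [hammingNorm, Finset.natCast_card_filter]
    rw [Finset.sum_congr rfl fun z _ => hnorm (c - z • c'), Finset.sum_comm,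
      Finset.sum_congr rfl fun i _ => hpt i, Finset.sum_sub_distrib, ← Finset.mul_sum,
      ← hnorm, ← hnorm]
  have hlt : ∀ z ∈ Finset.univ.erase (0 : ZMod p),
      (p - 1) * (hammingNorm c : ℤ) + 1 ≤ p * hammingNorm (c - z • c') := by
    intro z hz
    have hz0 := Finset.ne_of_mem_erase hz
    refine h _ (C.sub_mem hc (C.smul_mem z hc')) ?_ c hc hc0
    intro h0
    apply hne z⁻¹ (inv_ne_zero hz0)
    rw [sub_eq_zero.1 h0, inv_smul_smul₀ hz0]
  -- Comparing each c - z c' with c and summing gives p wt(c') < (p-1) wt(c), contrary to the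
  -- hypothesis applied to c' and c.
  have hle := Finset.card_nsmul_le_sum _ _ _ hlt
  rw [← Finset.mul_sum, hsum, Finset.card_erase_of_mem (Finset.mem_univ _), Finset.card_univ,
    ZMod.card, nsmul_eq_mul, Nat.cast_sub hp.out.one_le, Nat.cast_one] at hle
  have hlast := h c' hc' hc0' c hc hc0
  have hp1 : (1 : ℤ) < p := by exact_mod_cast hp.out.one_lt
  nlinarith

theorem weightRatioBound_of_weights {C : Submodule (ZMod p) (ι → ZMod p)}
    (hC : ∃ c ∈ C, c ≠ 0)
    (h : ∀ c ∈ C, c ≠ 0 → ∀ c' ∈ C, c' ≠ 0 →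
      (p - 1) * (hammingNorm c' : ℤ) < p * hammingNorm c) : WeightRatioBound C := by
  have hne : (nonzeroWeights C).Nonempty := by
    obtain ⟨c, hc, hc0⟩ := hC
    exact ⟨_, c, hc, hc0, rfl⟩
  have hbdd : BddAbove (nonzeroWeights C) := by
    refine ⟨Fintype.card ι, ?_⟩
    rintro _ ⟨c, -, -, rfl⟩
    exact hammingNorm_le_card_fintype
  have hmin := Nat.sInf_mem hne
  have hmax := Nat.sSup_mem hne hbdd
  refine ⟨sInf (nonzeroWeights C), sSup (nonzeroWeights C), ⟨hmin, fun w hw => Nat.sInf_le hw⟩,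
    ⟨hmax, fun w hw => le_csSup hbdd hw⟩, ?_⟩
  obtain ⟨c, hc, hc0, hcw⟩ := hmin
  obtain ⟨c', hc', hc0', hcw'⟩ := hmax
  have h1 := h c hc hc0 c' hc' hc0'
  rw [hcw, hcw'] at h1
  have hpos : (0 : ℝ) < (sSup (nonzeroWeights C) : ℕ) := by
    rw [← hcw']
    exact_mod_cast hammingNorm_pos_iff.2 hc0'
  have hp0 : (0 : ℝ) < p := by exact_mod_cast hp.out.pos
  rw [gt_iff_lt, div_lt_div_iff₀ hp0 hpos]
  have h2 : ((p : ℝ) - 1) * (sSup (nonzeroWeights C) : ℕ) < p * (sInf (nonzeroWeights C) : ℕ) := by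
    exact_mod_cast h1
  linarith

end CodeCriterion

/-! ### From deviation bounds to the code -/

section DeviationCriterion

variable {p : ℕ} [hp : Fact p.Prime] {F : Type*} [Field F] [Fintype F] [Algebra (ZMod p) F]

theorem weightRatioBound_and_isMinimalCode_of_deviation {f g : F → ZMod p} {lo hi : ℤ}
    (hdev : ∀ c, lo ≤ deviation f g c ∧ deviation f g c ≤ hi)
    (h : 0 < (Fintype.card F : ℤ) ^ 2 + deviation f g 0 - p * hi + (p - 1) * lo) :
    WeightRatioBound (code f g) ∧ IsMinimalCode (code f g) := by
  have hp1 : (1 : ℤ) < p := by exact_mod_cast hp.out.one_lt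
  have hcard : ((Finset.univ.erase (0 : ZMod p)).card : ℤ) = p - 1 := by
    rw [Finset.card_erase_of_mem (Finset.mem_univ _), Finset.card_univ, ZMod.card,
      Nat.cast_sub hp.out.one_le, Nat.cast_one]
  have hlow : ∀ c : F × F, c ≠ 0 → (p - 1) * ((Fintype.card F : ℤ) ^ 2 + deviation f g 0 - hi) ≤
      (p : ℤ) ^ 2 * hammingNorm (encode f g c) := by
    intro c hc
    rw [sq_mul_hammingNorm_encode f g hc]
    have := Finset.sum_le_card_nsmul (Finset.univ.erase (0 : ZMod p))
      (fun z => deviation f g (z • c)) hi fun z _ => (hdev _).2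
    rw [nsmul_eq_mul, hcard] at this
    linarith
  have hupp : ∀ c : F × F, c ≠ 0 → (p : ℤ) ^ 2 * hammingNorm (encode f g c) ≤
      (p - 1) * ((Fintype.card F : ℤ) ^ 2 + deviation f g 0 - lo) := by
    intro c hc
    rw [sq_mul_hammingNorm_encode f g hc]
    have := Finset.card_nsmul_le_sum (Finset.univ.erase (0 : ZMod p))
      (fun z => deviation f g (z • c)) lo fun z _ => (hdev _).1
    rw [nsmul_eq_mul, hcard] at this
    linarith
  -- The main inequality says this exceeds (p-1)(hi - lo) ≥ 0. It makes the lower weight bound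
  -- positive, so the code is nonzero.
  have hpos : 0 < (Fintype.card F : ℤ) ^ 2 + deviation f g 0 - hi := by
    have := (hdev 0).1.trans (hdev 0).2
    nlinarith
  have hweights : ∀ c ∈ code f g, c ≠ 0 → ∀ c' ∈ code f g, c' ≠ 0 →
      (p - 1) * (hammingNorm c' : ℤ) < p * hammingNorm c := by
    rintro _ ⟨c, rfl⟩ hc _ ⟨c', rfl⟩ hc'
    have h1 := hlow c (by rintro rfl; exact hc (map_zero _))
    have h2 := hupp c' (by rintro rfl; exact hc' (map_zero _))
    have h3 : 0 < (p : ℤ) ^ 2 := by positivity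
    refine lt_of_mul_lt_mul_left ?_ h3.le
    calc (p : ℤ) ^ 2 * ((p - 1) * hammingNorm (encode f g c'))
        = (p - 1) * ((p : ℤ) ^ 2 * hammingNorm (encode f g c')) := by ring
      _ ≤ (p - 1) * ((p - 1) * ((Fintype.card F : ℤ) ^ 2 + deviation f g 0 - lo)) :=
          mul_le_mul_of_nonneg_left h2 (by linarith)
      _ < p * ((p - 1) * ((Fintype.card F : ℤ) ^ 2 + deviation f g 0 - hi)) := by
          have h4 : (0 : ℤ) < p - 1 := by linarith
          nlinarith [mul_pos h4 h]
      _ ≤ p * ((p : ℤ) ^ 2 * hammingNorm (encode f g c)) :=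
          mul_le_mul_of_nonneg_left h1 (by linarith)
      _ = _ := by ring
  refine ⟨weightRatioBound_of_weights ⟨_, ⟨(1, 0), rfl⟩, ?_⟩ hweights,
    isMinimalCode_of_weights hweights⟩
  have h1 := hlow (1, 0) (by simp)
  have h2 : (0 : ℤ) < (p : ℤ) ^ 2 * hammingNorm (encode f g ((1, 0) : F × F)) :=
    lt_of_lt_of_le (mul_pos (by linarith) hpos) h1
  intro h0
  rw [h0] at h2
  simp at h2

end DeviationCriterion

/-! ### Values of the deviation -/

section Deviation

variable {p : ℕ} [hp : Fact p.Prime] {F : Type*} [Field F] [Fintype F] [Algebra (ZMod p) F]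
  {f g : F → ZMod p} {c : F × F}

theorem deviation_eq_zero (h : walsh f c.1 * walsh g c.2 = 0) : deviation f g c = 0 := by
  have := deviation_eq (f := f) (g := g) (c := c) (b := 0) (by simp [h])
  simpa using this

omit hp in
theorem sqrt_pow_two_mul (M : ℕ) : (Real.sqrt p : ℂ) ^ (2 * M) = (p : ℂ) ^ M := by
  rw [pow_mul, ← Complex.ofReal_pow, Real.sq_sqrt (Nat.cast_nonneg p), Complex.ofReal_natCast]

theorem mul_sqrt_pow_two_mul_eq_sum (ε : ℤ) (M : ℕ) (k : ZMod p) :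
    ε * (Real.sqrt p : ℂ) ^ (2 * M) * ZMod.stdAddChar k =
      ∑ j : ZMod p, ((if j = k then ε * (p : ℤ) ^ M else 0 : ℤ) : ℂ) * ZMod.stdAddChar j := by
  rw [sqrt_pow_two_mul, Finset.sum_eq_single k]
  · simp
  · intro j _ hj; simp [hj]
  · simp

theorem exists_mul_sqrt_pow_eq_sum (hp4 : p % 4 = 1) : ∃ δ : ℤ, (δ = 1 ∨ δ = -1) ∧
    ∀ (ε : ℤ) (M : ℕ) (k : ZMod p),
      ε * (Real.sqrt p : ℂ) ^ (2 * M + 1) * ZMod.stdAddChar k =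
        ∑ j : ZMod p, ((ε * δ * (p : ℤ) ^ M * quadraticChar (ZMod p) (j - k) : ℤ) : ℂ) *
          ZMod.stdAddChar j := by
  obtain ⟨δ, hδ, h⟩ := exists_sqrt_eq_sum hp4
  refine ⟨δ, hδ, fun ε M k => ?_⟩
  rw [pow_succ, sqrt_pow_two_mul, h, ← Equiv.sum_comp (Equiv.addRight k)
    (fun j => ((ε * δ * (p : ℤ) ^ M * quadraticChar (ZMod p) (j - k) : ℤ) : ℂ) *
      ZMod.stdAddChar j), Finset.mul_sum, Finset.mul_sum, Finset.sum_mul]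
  refine Finset.sum_congr rfl fun j _ => ?_
  rw [Equiv.coe_addRight, add_sub_cancel_right, AddChar.map_add_eq_mul]
  push_cast
  ring

theorem deviation_of_even {ε : ℤ} {M : ℕ} {k : ZMod p}
    (h : walsh f c.1 * walsh g c.2 = ε * (Real.sqrt p : ℂ) ^ (2 * M) * ZMod.stdAddChar k) :
    deviation f g c = if k = 0 then ε * (p : ℤ) ^ M * (p - 1) else -(ε * (p : ℤ) ^ M) := by
  rw [deviation_eq (h.trans (mul_sqrt_pow_two_mul_eq_sum ε M k)), Finset.sum_ite_eq',
    if_pos (Finset.mem_univ k)]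
  by_cases hk : k = 0
  · rw [if_pos hk.symm, if_pos hk]; ring
  · rw [if_neg (Ne.symm hk), if_neg hk]; ring

/-- The coefficients are ±p^M χ(j - k), with χ the quadratic character. Their sum is zero, so only p
times the coefficient at j = 0 survives, and it vanishes when k = 0. -/
theorem deviation_of_odd (hp4 : p % 4 = 1) {ε : ℤ} (hε : ε = 1 ∨ ε = -1) {M : ℕ} {k : ZMod p}
    (h : walsh f c.1 * walsh g c.2 = ε * (Real.sqrt p : ℂ) ^ (2 * M + 1) * ZMod.stdAddChar k) :
    (k = 0 → deviation f g c = 0) ∧ -(p : ℤ) ^ (M + 1) ≤ deviation f g c ∧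
      deviation f g c ≤ (p : ℤ) ^ (M + 1) := by
  obtain ⟨δ, hδ, hsum⟩ := exists_mul_sqrt_pow_eq_sum hp4
  have hchar : ∑ j : ZMod p, quadraticChar (ZMod p) (j - k) = 0 := by
    rw [← Equiv.sum_comp (Equiv.addRight k)]
    simp only [Equiv.coe_addRight, add_sub_cancel_right]
    refine quadraticChar_sum_zero ?_
    rw [ZMod.ringChar_zmod_n]; rintro rfl; simp at hp4
  rw [deviation_eq (h.trans (hsum ε M k)), ← Finset.mul_sum, hchar, mul_zero, sub_zero, zero_sub]
  have hpos : (0 : ℤ) ≤ (p : ℤ) ^ (M + 1) := by positivity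
  have heq : ∀ x : ℤ, (p : ℤ) * (ε * δ * (p : ℤ) ^ M * x) = ε * δ * x * (p : ℤ) ^ (M + 1) := by
    intro x; ring
  rw [heq]
  refine ⟨fun hk => by simp [hk], ?_⟩
  rcases quadraticChar_isQuadratic (ZMod p) (-k) with hx | hx | hx <;>
    rcases hε with rfl | rfl <;> rcases hδ with rfl | rfl <;> rw [hx] <;>
    constructor <;> linarith

end Deviation

/-! ### Parity of fibres and the exponent at the origin -/

section Parity

variable {p : ℕ} [hp : Fact p.Prime] {F : Type*} [Field F] [Fintype F] [Algebra (ZMod p) F]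
  {f g : F → ZMod p}

omit [Fintype F] in
theorem IsHomogeneous.map_neg (hf : IsHomogeneous f) (x : F) : f (-x) = f x := by
  obtain ⟨-, h, -, h2, -, hz⟩ := hf
  have := hz (-1) (neg_ne_zero.2 one_ne_zero) x
  rwa [neg_smul, one_smul, (even_iff_two_dvd.2 h2).neg_one_pow, one_mul] at this

/-- Negation is a fixed-point-free involution on S, so the terms of ∑ 1 cancel in pairs modulo 2. -/
theorem even_card_of_neg_mem {G : Type*} [AddGroup G] [DecidableEq G] {S : Finset G}
    (hneg : ∀ x : G, -x = x → x = 0) (h0 : (0 : G) ∉ S) (hS : ∀ x ∈ S, -x ∈ S) : Even S.card := by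
  rw [← ZMod.natCast_eq_zero_iff_even, ← nsmul_one, ← Finset.sum_const]
  refine Finset.sum_involution (fun x _ => -x) (fun _ _ => by decide) (fun x hx _ h => ?_)
    (fun x hx => hS x hx) (fun x _ => neg_neg x)
  exact h0 (hneg x h ▸ hx)

theorem neg_eq_self_imp (hp2 : 2 < p) {V : Type*} [AddCommGroup V] [Module (ZMod p) V] {x : V}
    (h : -x = x) : x = 0 := by
  have h2 : (2 : ZMod p) ≠ 0 := by
    intro h
    have := (ZMod.natCast_eq_zero_iff 2 p).1 (by exact_mod_cast h)
    exact absurd (Nat.le_of_dvd two_pos this) (by omega)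
  have h3 : (2 : ZMod p) • x = 0 := by
    rw [two_smul]; nth_rewrite 1 [← h]; exact neg_add_cancel x
  exact (smul_eq_zero.1 h3).resolve_left h2

omit [Fintype F] in
theorem phase_zero_neg (hf : IsHomogeneous f) (hg : IsHomogeneous g) (d : F × F) :
    phase f g 0 (-d) = phase f g 0 d := by
  simp [phase, hf.map_neg, hg.map_neg]

omit [Fintype F] in
theorem phase_zero_zero (hf : IsHomogeneous f) (hg : IsHomogeneous g) :
    phase f g 0 (0 : F × F) = 0 := by
  simp [phase, hf.1, hg.1]

theorem even_phaseCount (hp2 : 2 < p) (hf : IsHomogeneous f) (hg : IsHomogeneous g) {j : ZMod p}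
    (hj : j ≠ 0) : Even (phaseCount f g 0 j) := by
  classical
  rw [phaseCount, Int.even_coe_nat]
  refine even_card_of_neg_mem (fun x hx => neg_eq_self_imp hp2 hx) ?_ ?_
  · simp [phase_zero_zero hf hg, hj.symm]
  · simp [phase_zero_neg hf hg]

theorem odd_phaseCount_zero (hp2 : 2 < p) (hf : IsHomogeneous f) (hg : IsHomogeneous g) :
    Odd (phaseCount f g 0 0) := by
  classical
  rw [phaseCount, ← Finset.card_erase_add_one (a := (0 : F × F))
    (by simp [phase_zero_zero hf hg]), Int.odd_coe_nat]
  refine Even.add_one (even_card_of_neg_mem (fun x hx => neg_eq_self_imp hp2 hx) (by simp) ?_)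
  simp [phase_zero_neg hf hg]

theorem eq_zero_of_walsh_zero_even (hp2 : 2 < p) (hf : IsHomogeneous f) (hg : IsHomogeneous g)
    {ε : ℤ} {M : ℕ} {k : ZMod p}
    (h : walsh f 0 * walsh g 0 = ε * (Real.sqrt p : ℂ) ^ (2 * M) * ZMod.stdAddChar k) :
    k = 0 := by
  by_contra hk
  have hk2 : -k ≠ k := fun h => hk (neg_eq_self_imp hp2 h)
  -- If k ≠ 0, neither 0 nor -k carries the extra mass at k, so an odd count would equal an even
  -- one.
  have h1 := phaseCount_sub_eq (c := 0) (h.trans (mul_sqrt_pow_two_mul_eq_sum ε M k)) 0 (-k)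
  rw [if_neg (Ne.symm hk), if_neg hk2, sub_zero, sub_zero] at h1
  have h2 := odd_phaseCount_zero hp2 hf hg
  rw [h1] at h2
  exact Int.not_even_iff_odd.2 h2 (even_phaseCount hp2 hf hg (neg_ne_zero.2 hk))

theorem eq_zero_of_walsh_zero_odd (hp4 : p % 4 = 1) (hf : IsHomogeneous f)
    (hg : IsHomogeneous g) {ε : ℤ} (hε : ε = 1 ∨ ε = -1) {M : ℕ} {k : ZMod p}
    (h : walsh f 0 * walsh g 0 = ε * (Real.sqrt p : ℂ) ^ (2 * M + 1) * ZMod.stdAddChar k) :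
    k = 0 := by
  have hp2 : 2 < p := by
    have := hp.out.two_le
    omega
  obtain ⟨δ, hδ, hsum⟩ := exists_mul_sqrt_pow_eq_sum hp4
  by_contra hk
  have hk2 : -k ≠ k := fun h => hk (neg_eq_self_imp hp2 h)
  have hodd : ∀ x : ZMod p, x ≠ 0 → Odd (ε * δ * (p : ℤ) ^ M * quadraticChar (ZMod p) x) := by
    intro x hx
    have hsign : ∀ y : ℤ, y = 1 ∨ y = -1 → Odd y := by
      rintro y (rfl | rfl) <;> decide
    have hpodd : Odd (p : ℤ) := by
      rw [Int.odd_coe_nat]; exact hp.out.odd_of_ne_two hp2.ne'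
    exact (((hsign ε hε).mul (hsign δ hδ)).mul hpodd.pow).mul
      (hsign _ (quadraticChar_dichotomy hx))
  -- Both counts are even, but the coefficient at k is χ(0) = 0 and the one at -k is ±p^M, which is
  -- odd.
  have h2 := phaseCount_sub_eq (c := 0) (h.trans (hsum ε M k)) (-k) k
  have h4 := hodd (-k - k) (sub_ne_zero.2 hk2)
  have h5 := even_phaseCount hp2 hf hg hk
  have h6 := even_phaseCount hp2 hf hg (neg_ne_zero.2 hk)
  rw [sub_self, MulChar.map_zero, mul_zero, sub_zero] at h2
  rw [← h2] at h5
  exact Int.not_even_iff_odd.2 (h6.sub_odd h4) h5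

end Parity

/-! ### The size conditions, case by case -/

section Cases

variable {p : ℕ} [hp : Fact p.Prime] {F : Type*} [Field F] [Fintype F] [Algebra (ZMod p) F]
  {f g : F → ZMod p} {m s t r : ℕ}

theorem walsh_mul_walsh_eq_zero_or (hp4 : p % 4 = 1) (hf : IsWeaklyRegularPlateaued m s f)
    (hg : IsWeaklyRegularPlateaued m t g) (c : F × F) :
    walsh f c.1 * walsh g c.2 = 0 ∨ ∃ k : ZMod p, walsh f c.1 * walsh g c.2 =
      ((walshSign m s f * walshSign m t g : ℤ) : ℂ) * (Real.sqrt p : ℂ) ^ (2 * m + (s + t)) *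
        ZMod.stdAddChar k := by
  rcases hf.walsh_eq_zero_or hp4 c.1 with h1 | ⟨k, h1⟩
  · left; rw [h1, zero_mul]
  rcases hg.walsh_eq_zero_or hp4 c.2 with h2 | ⟨l, h2⟩
  · left; rw [h2, mul_zero]
  right
  refine ⟨k + l, ?_⟩
  rw [h1, h2, AddChar.map_add_eq_mul]
  push_cast
  ring

theorem walshSign_mul_walshSign (hp4 : p % 4 = 1) (hf : IsWeaklyRegularPlateaued m s f)
    (hg : IsWeaklyRegularPlateaued m t g) :
    walshSign m s f * walshSign m t g = 1 ∨ walshSign m s f * walshSign m t g = -1 := by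
  rcases (hf.isSignAndDual hp4).1 with h1 | h1 <;> rcases (hg.isSignAndDual hp4).1 with h2 | h2 <;>
    simp [h1, h2]

theorem deviation_mem_of_even (hp4 : p % 4 = 1) (hf : IsWeaklyRegularPlateaued m s f)
    (hg : IsWeaklyRegularPlateaued m t g) (hst : s + t = 2 * r) {ε : ℤ}
    (hε : walshSign m s f * walshSign m t g = ε) (c : F × F) :
    deviation f g c = 0 ∨ deviation f g c = ε * (p : ℤ) ^ (m + r) * (p - 1) ∨
      deviation f g c = -(ε * (p : ℤ) ^ (m + r)) := by
  rcases walsh_mul_walsh_eq_zero_or hp4 hf hg c with h | ⟨k, h⟩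
  · exact Or.inl (deviation_eq_zero h)
  · rw [hε, hst, ← mul_add] at h
    rw [deviation_of_even h]
    split_ifs <;> simp

/-- The fixed point of the sign change is the only odd fibre, which determines the deviation at
the origin. -/
theorem deviation_zero_of_even (hp4 : p % 4 = 1) (hf : WRP m s f) (hg : WRP m t g)
    (hst : s + t = 2 * r) {ε : ℤ} (hε : walshSign m s f * walshSign m t g = ε) :
    deviation f g 0 = ε * (p : ℤ) ^ (m + r) * (p - 1) := by
  have hp2 : 2 < p := by
    have := hp.out.two_le
    omega
  rcases walsh_mul_walsh_eq_zero_or hp4 hf.1 hg.1 0 with h | ⟨k, h⟩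
  · exact absurd h (mul_ne_zero hf.2.1 hg.2.1)
  · rw [hε, hst, ← mul_add] at h
    rw [deviation_of_even h, if_pos (eq_zero_of_walsh_zero_even hp2 hf.2.2 hg.2.2 h)]

theorem deviation_le_of_odd (hp4 : p % 4 = 1) (hf : IsWeaklyRegularPlateaued m s f)
    (hg : IsWeaklyRegularPlateaued m t g) (hst : s + t = 2 * r + 1) (c : F × F) :
    -(p : ℤ) ^ (m + r + 1) ≤ deviation f g c ∧ deviation f g c ≤ (p : ℤ) ^ (m + r + 1) := by
  rcases walsh_mul_walsh_eq_zero_or hp4 hf hg c with h | ⟨k, h⟩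
  · rw [deviation_eq_zero h]
    have : (0 : ℤ) ≤ (p : ℤ) ^ (m + r + 1) := by positivity
    constructor <;> linarith
  · rw [hst, ← add_assoc, ← mul_add] at h
    exact (deviation_of_odd hp4 (walshSign_mul_walshSign hp4 hf hg) h).2

theorem deviation_zero_of_odd (hp4 : p % 4 = 1) (hf : WRP m s f) (hg : WRP m t g)
    (hst : s + t = 2 * r + 1) : deviation f g 0 = 0 := by
  rcases walsh_mul_walsh_eq_zero_or hp4 hf.1 hg.1 0 with h | ⟨k, h⟩
  · exact deviation_eq_zero h
  · rw [hst, ← add_assoc, ← mul_add] at h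
    have hε := walshSign_mul_walshSign hp4 hf.1 hg.1
    exact (deviation_of_odd hp4 hε h).1 (eq_zero_of_walsh_zero_odd hp4 hf.2.2 hg.2.2 hε h)

theorem deviation_zero_of_balanced (hf : WRPB m s f) : deviation f g 0 = 0 :=
  deviation_eq_zero (by rw [Prod.fst_zero, hf.2.1, zero_mul])

omit [Field F] [Algebra (ZMod p) F] in
theorem pow_mul_pow_le_card_sq (hF : Fintype.card F = p ^ m) {a b : ℕ} (hab : a + b ≤ 2 * m) :
    (p : ℤ) ^ a * (p : ℤ) ^ b ≤ (Fintype.card F : ℤ) ^ 2 := by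
  rw [hF, Nat.cast_pow, ← pow_mul, ← pow_add, mul_comm m]
  exact pow_le_pow_right₀ (by exact_mod_cast hp.out.one_le) hab

theorem weightRatioBound_and_isMinimalCode_of_odd (hp4 : p % 4 = 1)
    (hF : Fintype.card F = p ^ m) (hf : IsWeaklyRegularPlateaued m s f)
    (hg : IsWeaklyRegularPlateaued m t g) (h0 : deviation f g 0 = 0)
    (hst : s + t = 2 * r + 1) (hm : r + 3 ≤ m) :
    WeightRatioBound (code f g) ∧ IsMinimalCode (code f g) := by
  refine weightRatioBound_and_isMinimalCode_of_deviation (deviation_le_of_odd hp4 hf hg hst) ?_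
  have h1 := pow_mul_pow_le_card_sq hF (a := m + r + 1) (b := 2) (by omega)
  have h2 : (1 : ℤ) < p := by exact_mod_cast hp.out.one_lt
  have h3 : (0 : ℤ) < (p : ℤ) ^ (m + r + 1) := by positivity
  rw [h0]
  -- With P = p^(m+r+1) the quantity is q² - (2p-1)P, at least (p-1)²P since q² ≥ p²P.
  nlinarith [mul_pos h3 (pow_pos (sub_pos.2 h2) 2)]

theorem weightRatioBound_and_isMinimalCode_of_pos (hp4 : p % 4 = 1)
    (hF : Fintype.card F = p ^ m) (hf : WRP m s f) (hg : WRP m t g)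
    (hst : s + t = 2 * r) (hε : walshSign m s f * walshSign m t g = 1) (hm : r + 2 ≤ m) :
    WeightRatioBound (code f g) ∧ IsMinimalCode (code f g) := by
  have h2 : (1 : ℤ) < p := by exact_mod_cast hp.out.one_lt
  have h3 : (0 : ℤ) < (p : ℤ) ^ (m + r) := by positivity
  have h4 := mul_pos h3 (sub_pos.2 h2)
  refine weightRatioBound_and_isMinimalCode_of_deviation (lo := -(p : ℤ) ^ (m + r))
    (hi := (p : ℤ) ^ (m + r) * (p - 1)) (fun c => ?_) ?_
  · rcases deviation_mem_of_even hp4 hf.1 hg.1 hst hε c with h | h | h <;> rw [h] <;>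
      constructor <;> linarith
  · have h1 := pow_mul_pow_le_card_sq hF (a := m + r) (b := 2) (by omega)
    rw [deviation_zero_of_even hp4 hf hg hst hε]
    -- With P = p^(m+r), the value Δ(0) = (p-1)P cancels (p-1)·lo, leaving q² - p(p-1)P ≥ pP.
    nlinarith

theorem weightRatioBound_and_isMinimalCode_of_neg (hp4 : p % 4 = 1)
    (hF : Fintype.card F = p ^ m) (hf : WRP m s f) (hg : WRP m t g)
    (hst : s + t = 2 * r) (hε : walshSign m s f * walshSign m t g = -1) (hm : r + 3 ≤ m) :
    WeightRatioBound (code f g) ∧ IsMinimalCode (code f g) := by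
  have h2 : (1 : ℤ) < p := by exact_mod_cast hp.out.one_lt
  have h3 : (0 : ℤ) < (p : ℤ) ^ (m + r) := by positivity
  have h4 := mul_pos h3 (sub_pos.2 h2)
  refine weightRatioBound_and_isMinimalCode_of_deviation
    (lo := -((p : ℤ) ^ (m + r) * (p - 1))) (hi := (p : ℤ) ^ (m + r)) (fun c => ?_) ?_
  · rcases deviation_mem_of_even hp4 hf.1 hg.1 hst hε c with h | h | h <;> rw [h] <;>
      constructor <;> linarith
  -- Here Δ(0) is negative and the quantity is exactly q² - p²P with P = p^(m+r), so q² ≥ p²P would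
  -- not suffice; hence the exponent 3.
  · have h1 := pow_mul_pow_le_card_sq hF (a := m + r) (b := 3) (by omega)
    rw [deviation_zero_of_even hp4 hf hg hst hε]
    have h5 : (0 : ℤ) < (p : ℤ) ^ (m + r) * (p : ℤ) ^ 2 * (p - 1) :=
      mul_pos (by positivity) (sub_pos.2 h2)
    nlinarith

theorem weightRatioBound_and_isMinimalCode_of_balanced (hp4 : p % 4 = 1)
    (hF : Fintype.card F = p ^ m) (hf : WRPB m s f) (hg : WRPB m t g)
    (hst : s + t = 2 * r) (hm : r + 2 ≤ m) :
    WeightRatioBound (code f g) ∧ IsMinimalCode (code f g) := by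
  have h2 : (1 : ℤ) < p := by exact_mod_cast hp.out.one_lt
  have h3 : (0 : ℤ) < (p : ℤ) ^ (m + r) := by positivity
  have h4 := mul_pos h3 (sub_pos.2 h2)
  have h1 := pow_mul_pow_le_card_sq hF (a := m + r) (b := 2) (by omega)
  have h0 : deviation f g 0 = 0 := deviation_zero_of_balanced hf
  -- As Δ(0) = 0, the quantity is q² - (p²-1)P for sign 1 and q² - (p²-p+1)P for sign -1, where P =
  -- p^(m+r); q² ≥ p²P suffices for both.
  rcases walshSign_mul_walshSign hp4 hf.1 hg.1 with hε | hε
  · refine weightRatioBound_and_isMinimalCode_of_deviation (lo := -(p : ℤ) ^ (m + r))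
      (hi := (p : ℤ) ^ (m + r) * (p - 1)) (fun c => ?_) ?_
    · rcases deviation_mem_of_even hp4 hf.1 hg.1 hst hε c with h | h | h <;> rw [h] <;>
        constructor <;> linarith
    · rw [h0]; nlinarith
  · refine weightRatioBound_and_isMinimalCode_of_deviation
      (lo := -((p : ℤ) ^ (m + r) * (p - 1))) (hi := (p : ℤ) ^ (m + r)) (fun c => ?_) ?_
    · rcases deviation_mem_of_even hp4 hf.1 hg.1 hst hε c with h | h | h <;> rw [h] <;>
        constructor <;> linarith
    · rw [h0]; nlinarith

end Cases

end PlateauedCode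

theorem mainTheorem7 {p : ℕ} [Fact p.Prime] (hp : p % 4 = 1)
    {F : Type*} [Field F] [Fintype F] [Algebra (ZMod p) F]
    (m : ℕ) (hm : 2 ≤ m) (hF : Fintype.card F = p ^ m)
    (f g : F → ZMod p) (s t lf lg : ℕ)
    (hlf : PlateauedCode.IsIndex m s f lf) (hlg : PlateauedCode.IsIndex m t g lg)
    (hlg' : lg = (p - 1) / 2) :
    -- the case of odd `s + t`
    (((PlateauedCode.WRP m s f ∧ PlateauedCode.WRP m t g) ∨
        (PlateauedCode.WRPB m s f ∧ PlateauedCode.WRPB m t g)) →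
      Odd (s + t) →
      (lf = (p - 1) / 2 ∨ lf = p - 1 ∨ (lf = 2 ∧ p % 8 = 1)) →
      2 * (m : ℤ) - s - t ≥ 5 →
      PlateauedCode.WeightRatioBound (PlateauedCode.code f g) ∧
        PlateauedCode.IsMinimalCode (PlateauedCode.code f g)) ∧
    -- the unbalanced case with even `s + t`
    (PlateauedCode.WRP m s f → PlateauedCode.WRP m t g →
      Even (s + t) →
      (lf = (p - 1) / 2 ∨ lf = p - 1 ∨ lf = 2) →
      ((PlateauedCode.walshSign m s f * PlateauedCode.walshSign m t g = 1 ∧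
          2 * (m : ℤ) - s - t ≥ 4) ∨
        (PlateauedCode.walshSign m s f * PlateauedCode.walshSign m t g = -1 ∧
          2 * (m : ℤ) - s - t ≥ 6)) →
      PlateauedCode.WeightRatioBound (PlateauedCode.code f g) ∧
        PlateauedCode.IsMinimalCode (PlateauedCode.code f g)) ∧
    -- the balanced case with even `s + t`
    (PlateauedCode.WRPB m s f → PlateauedCode.WRPB m t g →
      Even (s + t) →
      (lf = (p - 1) / 2 ∨ lf = p - 1 ∨ lf = 2) →
      2 * (m : ℤ) - s - t ≥ 4 →
      PlateauedCode.WeightRatioBound (PlateauedCode.code f g) ∧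
        PlateauedCode.IsMinimalCode (PlateauedCode.code f g)) := by
  refine ⟨fun h hodd _ hm => ?_, fun hf hg heven _ h => ?_, fun hf hg heven _ hm => ?_⟩
  · obtain ⟨r, hr⟩ := hodd
    rcases h with ⟨hf, hg⟩ | ⟨hf, hg⟩
    · exact PlateauedCode.weightRatioBound_and_isMinimalCode_of_odd hp hF hf.1 hg.1
        (PlateauedCode.deviation_zero_of_odd hp hf hg hr) hr (by omega)
    · exact PlateauedCode.weightRatioBound_and_isMinimalCode_of_odd hp hF hf.1 hg.1
        (PlateauedCode.deviation_zero_of_balanced hf) hr (by omega)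
  · obtain ⟨r, hr⟩ := heven
    rcases h with ⟨hε, hm⟩ | ⟨hε, hm⟩
    · exact PlateauedCode.weightRatioBound_and_isMinimalCode_of_pos hp hF hf hg
        (r := r) (by omega) hε (by omega)
    · exact PlateauedCode.weightRatioBound_and_isMinimalCode_of_neg hp hF hf hg
        (r := r) (by omega) hε (by omega)
  · obtain ⟨r, hr⟩ := heven
    exact PlateauedCode.weightRatioBound_and_isMinimalCode_of_balanced hp hF hf hg
      (r := r) (by omega) (by omega)
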